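/- Addition theorem. All metric spaces below are proper (closed balls are compact) or subspaces of proper spaces. Two subsets $A,B$ of a metric space $X$ are asymptotically disjoint if for every $R$ there is a bounded set $K\subset X$ with $d(a,b)\ge R$ for all $a\in A\setminus K$, $b\in B\setminus K$. Let $C_h(X)$ be the set of all continuous $\phi:X\to[0,1]$ such that for all $r,\varepsilon>0$ one has $\operatorname{diam}\phi(B_r(x))<\varepsilon$ for all $x$ outside some bounded set. The Higson compactification $cX$ is the closure of the image of $X$ under $\Phi:X\to[0,1]^{C_h(X)}$, $\Phi(x)=(\phi(x))_{\phi}$, and the Higson corona $\nu X$ is the set of points of $cX$ that do not lie in the closure of $\Phi(K)$ for any bounded $K\subset X$; for proper $X$ this is $cX\setminus\Phi(X)$. For $C\subset X$ let $C'=\overline{\Phi(C)}\cap\nu X$. A closed set $C\subset X$ is an asymptotic separator for asymptotically disjoint sets $A,B\subset X$ if $C'$ is a partition between $A'$ and $B'$ in $\nu X$, i.e. $\nu X\setminus C'=U_1\cup U_2$ with $U_1,U_2$ disjoint open subsets of $\nu X$, $A'\subset U_1$, $B'\subset U_2$. The asymptotic large inductive dimension is defined inductively: $\operatorname{asInd}X=-1$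 if and only if $X$ is bounded; for $n\ge 0$, $\operatorname{asInd}X\le n$ if every two asymptotically disjoint sets $A,B\subset X$ have an asymptotic separator $C$ with $\operatorname{asInd}C\le n-1$, where $C$ is regarded as a metric space with the restricted metric; $\operatorname{asInd}X$ is the least such $n$, and $\operatorname{asInd}X=\infty$ if there is none. Theorem. Let $X$ be a proper metric space and $X=Y\cup Z$, where $Y$ and $Z$ are unbounded subsets of $X$. Then $\operatorname{asInd}X\le\operatorname{asInd}Y+\operatorname{asInd}Z$. -/

import Mathlib

universe u

/-- `C` is a partition between `A₁` and `A₂` in the topological space `T`. -/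
def IsPartition {T : Type*} [TopologicalSpace T] (A₁ A₂ C : Set T) : Prop :=
  ∃ U₁ U₂ : Set T, IsOpen U₁ ∧ IsOpen U₂ ∧ Disjoint U₁ U₂ ∧
    Cᶜ = U₁ ∪ U₂ ∧ A₁ ⊆ U₁ ∧ A₂ ⊆ U₂

/-- `lim_{r → ∞} d (A₁ \ B_r(x₀), A₂ \ B_r(x₀)) = ∞`. As every bounded set lies in a ball about
the base point `x₀` and conversely, bounded sets `K` replace these balls, and no base point has to
be chosen. -/
def AsymptoticallyDisjoint {X : Type*} [MetricSpace X] (A₁ A₂ : Set X) : Prop :=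
  ∀ R : ℝ, ∃ K : Set X, Bornology.IsBounded K ∧ ∀ a ∈ A₁ \ K, ∀ b ∈ A₂ \ K, R ≤ dist a b

/-- Slowly oscillating maps to the unit interval (again with a bounded set `K` in place of a ball
about the base point). -/
def SlowlyOscillating {X : Type*} [MetricSpace X] (φ : X → unitInterval) : Prop :=
  ∀ r > 0, ∀ ε > 0, ∃ K : Set X, Bornology.IsBounded K ∧
    ∀ x ∉ K, Metric.diam (φ '' Metric.ball x r) < ε

/-- The set `C_h(X)` of continuous slowly oscillating functions `X → [0, 1]`. -/
def HigsonFunction (X : Type*) [MetricSpace X] : Type _ :=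
  {φ : X → unitInterval // Continuous φ ∧ SlowlyOscillating φ}

/-- The canonical map `Φ : X → [0, 1] ^ C_h(X)`. -/
def higsonMap (X : Type*) [MetricSpace X] (x : X) : HigsonFunction X → unitInterval :=
  fun φ => φ.1 x

/-- The Higson compactification `cX`: the closure of the image of `Φ` in `[0, 1] ^ C_h(X)`. -/
def higsonCompactification (X : Type*) [MetricSpace X] :
    Set (HigsonFunction X → unitInterval) :=
  closure (Set.range (higsonMap X))

/-- The Higson corona `νX`: the points of `cX` that are not in the closure of a bounded subset of
`X`. If `X` is proper this is the remainder `cX \ X`, see `higsonCorona_eq_remainder`; the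
definition makes sense for a metric space that is not proper, such as a subset of a proper space
that is not closed. -/
def higsonCorona (X : Type*) [MetricSpace X] : Set (HigsonFunction X → unitInterval) :=
  {ξ ∈ higsonCompactification X |
    ∀ K : Set X, Bornology.IsBounded K → ξ ∉ closure (higsonMap X '' K)}

theorem continuous_higsonMap (X : Type*) [MetricSpace X] : Continuous (higsonMap X) :=
  continuous_pi fun φ => φ.2.1

/-- For a proper metric space the Higson corona is `cX \ X`. -/
theorem higsonCorona_eq_remainder (X : Type*) [MetricSpace X] [ProperSpace X] :
    higsonCorona X = higsonCompactification X \ Set.range (higsonMap X) := by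
  ext ξ
  constructor
  · rintro ⟨h, hK⟩
    refine ⟨h, ?_⟩
    rintro ⟨x, rfl⟩
    exact hK {x} Bornology.isBounded_singleton (subset_closure ⟨x, rfl, rfl⟩)
  · rintro ⟨h, hr⟩
    refine ⟨h, fun K hK hξ => hr ?_⟩
    have hc : IsCompact (higsonMap X '' closure K) :=
      hK.isCompact_closure.image (continuous_higsonMap X)
    obtain ⟨x, -, hx⟩ := closure_minimal (Set.image_mono subset_closure) hc.isClosed hξ
    exact ⟨x, hx⟩

/-- The trace `C' = cl C ∩ νX` of `C ⊆ X` in the Higson corona, as a subset of the space `νX`. -/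
def coronaTrace {X : Type*} [MetricSpace X] (C : Set X) : Set (higsonCorona X) :=
  {ξ | (ξ : HigsonFunction X → unitInterval) ∈ closure (higsonMap X '' C)}

/-- `C` is an asymptotic separator for `A₁` and `A₂`. -/
def IsAsymptoticSeparator {X : Type*} [MetricSpace X] (A₁ A₂ C : Set X) : Prop :=
  IsClosed C ∧ IsPartition (coronaTrace A₁) (coronaTrace A₂) (coronaTrace C)

/-- `AsIndLE k X` says `asInd X ≤ k - 1` (the index is shifted as the dimension starts at `-1`). -/
def AsIndLE : ℕ → (X : Type u) → [MetricSpace X] → Prop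
  | 0, X, _ => Bornology.IsBounded (Set.univ : Set X)
  | k + 1, X, _ => ∀ A B : Set X, AsymptoticallyDisjoint A B →
      ∃ C : Set X, IsAsymptoticSeparator A B C ∧ AsIndLE k C

open Classical in
/-- The asymptotic large inductive dimension: the least integer `n ≥ -1` with `asInd X ≤ n`, and
`∞` if there is none. -/
noncomputable def asInd (X : Type u) [MetricSpace X] : WithTop ℤ :=
  if h : ∃ k, AsIndLE k X then (((Nat.find h : ℤ) - 1 : ℤ) : WithTop ℤ) else ⊤

/-! ### Asymptotic disjointness, bilipschitz maps and sparse subsets. -/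

section AsymptoticDisjointness

open Bornology

variable {X Y : Type*} [MetricSpace X] [MetricSpace Y] {A B C A' B' : Set X}

/-! Call sets apart if they are asymptotically disjoint. This means that their corona traces are
disjoint, so by compactness of νX a partition by C' amounts to a coherent splitting of all sets
apart from C (`coarselySeparates_iff`). The rest is metric.

The dimension is monotone under bilipschitz embeddings f: points of the source, chosen sparser the
farther their images are from a separator C, can be moved into C with bounded distortion, yet still
coarsely trace the preimages of all neighbourhoods of C (`exists_bilipschitz_trace`).

The addition theorem is an induction on the bound for asInd Y. If it is 0, Y splits into two pieces
apart from each other, which are joined to A and B; separating the enlarged sets inside Z separates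
A and B in X. Otherwise let C separate neighbourhoods of A and B inside Y. Then C ∪ Z, with smaller
neighbourhoods of A and B removed, separates A and B in X, and the induction hypothesis bounds its
dimension, as C has smaller dimension than Y. -/

theorem asymptoticallyDisjoint_iff :
    AsymptoticallyDisjoint A B ↔ ∀ R : ℝ, ∃ K : Set X, IsBounded K ∧
      ∀ a ∈ A, ∀ b ∈ B, dist a b < R → a ∈ K ∧ b ∈ K := by
  constructor
  · intro h R
    obtain ⟨K, hK, hd⟩ := h R
    refine ⟨K ∪ Metric.thickening R K, hK.union hK.thickening, fun a ha b hb hab => ?_⟩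
    by_cases haK : a ∈ K
    · exact ⟨Or.inl haK, Or.inr (Metric.mem_thickening_iff.2 ⟨a, haK, by rwa [dist_comm]⟩)⟩
    by_cases hbK : b ∈ K
    · exact ⟨Or.inr (Metric.mem_thickening_iff.2 ⟨b, hbK, hab⟩), Or.inl hbK⟩
    exact absurd hab (not_lt.2 (hd a ⟨ha, haK⟩ b ⟨hb, hbK⟩))
  · intro h R
    obtain ⟨K, hK, hd⟩ := h R
    refine ⟨K, hK, fun a ha b hb => ?_⟩
    by_contra! hab
    exact ha.2 (hd a ha.1 b hb.1 hab).1

namespace AsymptoticallyDisjoint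

theorem symm (h : AsymptoticallyDisjoint A B) : AsymptoticallyDisjoint B A := by
  intro R
  obtain ⟨K, hK, hd⟩ := h R
  exact ⟨K, hK, fun a ha b hb => by rw [dist_comm]; exact hd b hb a ha⟩

theorem mono (h : AsymptoticallyDisjoint A B) (hA : A' ⊆ A) (hB : B' ⊆ B) :
    AsymptoticallyDisjoint A' B' := by
  intro R
  obtain ⟨K, hK, hd⟩ := h R
  exact ⟨K, hK, fun a ha b hb => hd a ⟨hA ha.1, ha.2⟩ b ⟨hB hb.1, hb.2⟩⟩

theorem union_left (h : AsymptoticallyDisjoint A C) (h' : AsymptoticallyDisjoint B C) :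
    AsymptoticallyDisjoint (A ∪ B) C := by
  intro R
  obtain ⟨K, hK, hd⟩ := h R
  obtain ⟨K', hK', hd'⟩ := h' R
  refine ⟨K ∪ K', hK.union hK', ?_⟩
  rintro a ⟨ha | ha, haK⟩ b ⟨hb, hbK⟩
  · exact hd a ⟨ha, fun h => haK (Or.inl h)⟩ b ⟨hb, fun h => hbK (Or.inl h)⟩
  · exact hd' a ⟨ha, fun h => haK (Or.inr h)⟩ b ⟨hb, fun h => hbK (Or.inr h)⟩

theorem union_right (h : AsymptoticallyDisjoint A B) (h' : AsymptoticallyDisjoint A C) :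
    AsymptoticallyDisjoint A (B ∪ C) :=
  (h.symm.union_left h'.symm).symm

theorem of_isBounded (hA : IsBounded A) (B : Set X) : AsymptoticallyDisjoint A B :=
  fun _ => ⟨A, hA, fun _ ha => absurd ha.1 ha.2⟩

theorem isBounded_inter (h : AsymptoticallyDisjoint A B) : IsBounded (A ∩ B) := by
  obtain ⟨K, hK, hd⟩ := asymptoticallyDisjoint_iff.1 h 1
  exact hK.subset fun x hx => (hd x hx.1 x hx.2 (by simp)).1

theorem of_near (h : AsymptoticallyDisjoint A B) (T : ℝ)
    (hT : ∀ x ∈ A', ∃ a ∈ A, dist x a ≤ T) : AsymptoticallyDisjoint A' B := by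
  rw [asymptoticallyDisjoint_iff] at h ⊢
  intro R
  obtain ⟨K, hK, hd⟩ := h (T + R)
  refine ⟨K ∪ Metric.thickening R K, hK.union hK.thickening, fun x hx b hb hxb => ?_⟩
  obtain ⟨a, ha, hxa⟩ := hT x hx
  have hbK := (hd a ha b hb (by
    calc dist a b ≤ dist x a + dist x b := dist_triangle_left a b x
      _ < T + R := by linarith)).2
  exact ⟨Or.inr (Metric.mem_thickening_iff.2 ⟨b, hbK, hxb⟩), Or.inl hbK⟩

/-- If `S ⊆ Z` is asymptotically disjoint from the part in `Z` of an asymptotic neighbourhood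
`A'` of `A`, then it is asymptotically disjoint from `A`. -/
theorem of_inter {S Z : Set X} (h : AsymptoticallyDisjoint A A'ᶜ) (hS : S ⊆ Z)
    (h' : AsymptoticallyDisjoint S (A' ∩ Z)) : AsymptoticallyDisjoint S A := by
  have h₁ : AsymptoticallyDisjoint (S ∩ (A' ∩ Z)) A := of_isBounded h'.isBounded_inter _
  refine (h₁.union_left h.symm).mono (fun x hx => ?_) subset_rfl
  by_cases hxA : x ∈ A'
  · exact Or.inl ⟨hx, hxA, hS hx⟩
  · exact Or.inr hxA

/-- Coarse normality. `A₁` consists of the points at least as close to some point of A as to all of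
B. A point within R of the wrong side yields a pair in A × B at distance less than 2R, and such
pairs are confined to a bounded set. -/
theorem exists_between (h : AsymptoticallyDisjoint A B) :
    ∃ A₁, A ⊆ A₁ ∧ AsymptoticallyDisjoint A A₁ᶜ ∧ AsymptoticallyDisjoint A₁ B := by
  rw [asymptoticallyDisjoint_iff] at h
  refine ⟨{x | ∃ a ∈ A, ∀ b ∈ B, dist x a ≤ dist x b},
    fun a ha => ⟨a, ha, fun b _ => by simp⟩, ?_, ?_⟩
  · rw [asymptoticallyDisjoint_iff]
    intro R
    obtain ⟨K, hK, hd⟩ := h (R + R)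
    refine ⟨K ∪ Metric.thickening R K, hK.union hK.thickening, fun a ha x hx hax => ?_⟩
    simp only [Set.mem_compl_iff, Set.mem_ofPred_eq, not_exists, not_and, not_forall, not_le] at hx
    obtain ⟨b, hb, hxb⟩ := hx a ha
    have haK := (hd a ha b hb (by
      have := dist_triangle a x b
      have := dist_comm a x
      linarith)).1
    exact ⟨Or.inl haK, Or.inr (Metric.mem_thickening_iff.2 ⟨a, haK, by rwa [dist_comm]⟩)⟩
  · rw [asymptoticallyDisjoint_iff]
    intro R
    obtain ⟨K, hK, hd⟩ := h (R + R)
    refine ⟨K ∪ Metric.thickening R K, hK.union hK.thickening, ?_⟩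
    rintro x ⟨a, ha, hxa⟩ b hb hxb
    have hbK := (hd a ha b hb (by
      have := dist_triangle_left a b x
      have := hxa b hb
      linarith)).2
    exact ⟨Or.inr (Metric.mem_thickening_iff.2 ⟨b, hbK, hxb⟩), Or.inl hbK⟩

theorem exists_neighbourhoods (h : AsymptoticallyDisjoint A B) :
    ∃ A₁ B₁, A ⊆ A₁ ∧ B ⊆ B₁ ∧ AsymptoticallyDisjoint A A₁ᶜ ∧ AsymptoticallyDisjoint B B₁ᶜ ∧
      AsymptoticallyDisjoint A₁ B₁ := by
  obtain ⟨A₁, hA, hA₁, h₁⟩ := h.exists_between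
  obtain ⟨B₁, hB, hB₁, h₂⟩ := h₁.symm.exists_between
  exact ⟨A₁, B₁, hA, hB, hA₁, hB₁, h₂.symm⟩

end AsymptoticallyDisjoint

/-- `f` is a bilipschitz embedding. -/
def IsBilipschitz (f : X → Y) : Prop :=
  ∃ c : ℝ, 0 < c ∧ ∀ x y, dist x y ≤ c * dist (f x) (f y) ∧ dist (f x) (f y) ≤ c * dist x y

theorem Isometry.isBilipschitz {f : X → Y} (hf : Isometry f) : IsBilipschitz f :=
  ⟨1, one_pos, fun x y => by simp [hf.dist_eq]⟩

theorem IsBilipschitz.isBounded_image {f : X → Y} (hf : IsBilipschitz f) {K : Set X}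
    (hK : IsBounded K) : IsBounded (f '' K) := by
  obtain ⟨c, hc, h⟩ := hf
  obtain ⟨M, hM⟩ := Metric.isBounded_iff.1 hK
  refine Metric.isBounded_iff.2 ⟨c * M, ?_⟩
  rintro _ ⟨x, hx, rfl⟩ _ ⟨y, hy, rfl⟩
  exact (h x y).2.trans (mul_le_mul_of_nonneg_left (hM hx hy) hc.le)

theorem IsBilipschitz.isBounded_preimage {f : X → Y} (hf : IsBilipschitz f) {K : Set Y}
    (hK : IsBounded K) : IsBounded (f ⁻¹' K) := by
  obtain ⟨c, hc, h⟩ := hf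
  obtain ⟨M, hM⟩ := Metric.isBounded_iff.1 hK
  refine Metric.isBounded_iff.2 ⟨c * M, ?_⟩
  intro x hx y hy
  exact (h x y).1.trans (mul_le_mul_of_nonneg_left (hM hx hy) hc.le)

theorem IsBilipschitz.asymptoticallyDisjoint_image_iff {f : X → Y} (hf : IsBilipschitz f) :
    AsymptoticallyDisjoint (f '' A) (f '' B) ↔ AsymptoticallyDisjoint A B := by
  obtain ⟨c, hc, h⟩ := id hf
  simp only [asymptoticallyDisjoint_iff]
  constructor
  · intro H R
    obtain ⟨K, hK, hd⟩ := H (c * R)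
    refine ⟨f ⁻¹' K, hf.isBounded_preimage hK, fun a ha b hb hab => ?_⟩
    exact hd _ ⟨a, ha, rfl⟩ _ ⟨b, hb, rfl⟩
      ((h a b).2.trans_lt (mul_lt_mul_of_pos_left hab hc))
  · intro H R
    obtain ⟨K, hK, hd⟩ := H (c * R)
    refine ⟨f '' K, hf.isBounded_image hK, ?_⟩
    rintro _ ⟨a, ha, rfl⟩ _ ⟨b, hb, rfl⟩ hab
    have := hd a ha b hb ((h a b).1.trans_lt (mul_lt_mul_of_pos_left hab hc))
    exact ⟨⟨a, this.1, rfl⟩, ⟨b, this.2, rfl⟩⟩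

/-- A subset of `S` that meets the ball of radius `T (ℓ x)` about each `x ∈ S`, with points as
far apart as their levels `ℓ` demand. -/
theorem exists_sparse_subset (S : Set X) (ℓ : X → ℕ) (T : ℕ → ℝ) :
    ∃ E ⊆ S, (∀ x ∈ E, ∀ y ∈ E, x ≠ y → T (max (ℓ x) (ℓ y)) ≤ dist x y) ∧
      ∀ x ∈ S, ∃ y ∈ E, y = x ∨ dist x y < T (ℓ x) := by
  -- Greedy selection along a well-order that lists lower levels first: a point is kept if it is far
  -- from all points kept before. Of two kept points the later one has the larger level, hence the
  -- maximum in the separation.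
  let r : X → X → Prop :=
    InvImage (Prod.Lex (· < ·) WellOrderingRel) fun x => (ℓ x, x)
  have wf : WellFounded r :=
    InvImage.wf _ (WellFounded.prod_lex wellFounded_lt IsWellFounded.wf)
  let P : X → Prop := wf.fix fun x P => x ∈ S ∧ ∀ y (h : r y x), P y h → T (ℓ x) ≤ dist x y
  have hP : ∀ x, P x ↔ x ∈ S ∧ ∀ y, r y x → P y → T (ℓ x) ≤ dist x y := fun x =>
    iff_of_eq (wf.fix_eq _ x)
  have hr : ∀ x y, r y x → ℓ y ≤ ℓ x := by
    intro x y h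
    rcases Prod.lex_def.1 h with h | h
    · exact h.le
    · exact h.1.le
  have htri : ∀ x y, x ≠ y → r y x ∨ r x y := by
    intro x y hxy
    rcases lt_trichotomy (ℓ x) (ℓ y) with h | h | h
    · exact Or.inr (Prod.Lex.left _ _ h)
    · rcases trichotomous_of WellOrderingRel x y with h' | h' | h'
      · exact Or.inr (Prod.lex_def.2 (Or.inr ⟨h, h'⟩))
      · exact absurd h' hxy
      · exact Or.inl (Prod.lex_def.2 (Or.inr ⟨h.symm, h'⟩))
    · exact Or.inl (Prod.Lex.left _ _ h)
  refine ⟨{x | P x}, fun x hx => ((hP x).1 hx).1, fun x hx y hy hxy => ?_, fun x hx => ?_⟩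
  · rcases htri x y hxy with h | h
    · rw [max_eq_left (hr _ _ h)]
      exact ((hP x).1 hx).2 y h hy
    · rw [max_eq_right (hr _ _ h), dist_comm]
      exact ((hP y).1 hy).2 x h hx
  · by_cases hPx : P x
    · exact ⟨x, hPx, Or.inl rfl⟩
    · rw [hP] at hPx
      push Not at hPx
      obtain ⟨y, -, hy, hxy⟩ := hPx hx
      exact ⟨y, hy, Or.inr hxy⟩

/-- Separators have to be closed; passing to such a net achieves this without changing which sets
are apart from S. -/
theorem exists_net (S : Set X) : ∃ E ⊆ S, IsClosed E ∧ ∀ x ∈ S, ∃ y ∈ E, dist x y ≤ 1 := by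
  obtain ⟨E, hES, hsep, hnet⟩ := exists_sparse_subset S (fun _ => 0) (fun _ => 1)
  refine ⟨E, hES, Metric.isClosed_of_pairwise_le_dist one_pos fun x hx y hy => hsep x hx y hy,
    fun x hx => ?_⟩
  obtain ⟨y, hy, rfl | h⟩ := hnet x hx
  · exact ⟨y, hy, by simp⟩
  · exact ⟨y, hy, h.le⟩

/-- The preimages of all bounded neighbourhoods of `C` are coarsely covered by a closed set which
has a bilipschitz embedding into `C`. -/
theorem exists_bilipschitz_trace {f : X → Y} (hf : IsBilipschitz f) (C : Set Y) :
    ∃ E : Set X, (∀ F ⊆ E, IsClosed F ∧ ∃ g : F → C, IsBilipschitz g) ∧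
      ∀ R : ℝ, ∃ T : ℝ, ∀ x, (∃ y ∈ C, dist (f x) y < R) → ∃ e ∈ E, dist x e ≤ T := by
  obtain ⟨c, hc, h⟩ := id hf
  rcases C.eq_empty_or_nonempty with rfl | hC
  · refine ⟨∅, fun F hF => ?_, fun R => ⟨0, by simp⟩⟩
    obtain rfl := Set.subset_empty_iff.1 hF
    exact ⟨isClosed_empty, fun x => (x.2 : False).elim, 1, one_pos, fun x => (x.2 : False).elim⟩
  have hlev : ∀ x, ∃ n : ℕ, ∃ y ∈ C, dist (f x) y < n := by
    intro x
    obtain ⟨y, hy⟩ := hC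
    obtain ⟨n, hn⟩ := exists_nat_gt (dist (f x) y)
    exact ⟨n, y, hy, hn⟩
  classical
  let ℓ : X → ℕ := fun x => Nat.find (hlev x)
  choose p hpC hp using fun x => Nat.find_spec (hlev x)
  -- The level bounds the distance from `f x` to `p x`. For distinct points of E with maximal level
  -- m the images are at least 4m apart, and moving both into C changes their distance by at most
  -- 2m, that is, by at most half. The summand 1 makes all subsets of E closed.
  obtain ⟨E, -, hsep, hnet⟩ :=
    exists_sparse_subset Set.univ ℓ (fun n => 1 + c * (4 * n))
  refine ⟨E, fun F hF => ⟨?_, fun x => ⟨p x, hpC x⟩, 2 * c, by positivity, ?_⟩, fun R => ?_⟩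
  · refine Metric.isClosed_of_pairwise_le_dist one_pos fun x hx y hy hxy => ?_
    refine le_trans ?_ (hsep x (hF hx) y (hF hy) hxy)
    have : 0 ≤ c * (4 * ((max (ℓ x) (ℓ y) : ℕ) : ℝ)) := by positivity
    linarith
  · rintro ⟨x, hx⟩ ⟨y, hy⟩
    rcases eq_or_ne x y with rfl | hxy
    · simp
    have h₁ := hsep x (hF hx) y (hF hy) hxy
    have hx' : dist (f x) (p x) ≤ ((max (ℓ x) (ℓ y) : ℕ) : ℝ) :=
      (hp x).le.trans (by exact_mod_cast le_max_left _ _)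
    have hy' : dist (f y) (p y) ≤ ((max (ℓ x) (ℓ y) : ℕ) : ℝ) :=
      (hp y).le.trans (by exact_mod_cast le_max_right _ _)
    generalize ((max (ℓ x) (ℓ y) : ℕ) : ℝ) = m at *
    have h₂ : 4 * m ≤ dist (f x) (f y) := by
      have : c * (4 * m) ≤ c * dist (f x) (f y) := by linarith [(h x y).1]
      exact le_of_mul_le_mul_left this hc
    have h₃ : dist (f x) (f y) ≤ dist (f x) (p x) + dist (p x) (p y) + dist (f y) (p y) := by
      rw [dist_comm (f y)]; exact dist_triangle4 _ _ _ _
    have h₄ : dist (p x) (p y) ≤ dist (f x) (p x) + dist (f x) (f y) + dist (f y) (p y) := by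
      rw [dist_comm (f x) (p x)]; exact dist_triangle4 _ _ _ _
    change dist x y ≤ 2 * c * dist (p x) (p y) ∧ dist (p x) (p y) ≤ 2 * c * dist x y
    constructor
    · have : c * dist (f x) (f y) ≤ c * (2 * dist (p x) (p y)) :=
        mul_le_mul_of_nonneg_left (by linarith) hc.le
      linarith [(h x y).1]
    · linarith [(h x y).2]
  · obtain ⟨n, hn⟩ := exists_nat_ge R
    refine ⟨1 + c * (4 * n), fun x ⟨y, hy, hxy⟩ => ?_⟩
    have hℓ : ((ℓ x : ℕ) : ℝ) ≤ n := by
      exact_mod_cast Nat.find_min' (hlev x) ⟨y, hy, hxy.trans_le hn⟩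
    have hT : 1 + c * (4 * (ℓ x : ℝ)) ≤ 1 + c * (4 * n) := by gcongr
    obtain ⟨e, he, rfl | h'⟩ := hnet x trivial
    · exact ⟨e, he, by rw [dist_self]; positivity⟩
    · exact ⟨e, he, h'.le.trans hT⟩

end AsymptoticDisjointness

/-! ### The Higson corona and coarse separation. -/

section HigsonCorona

open Bornology Filter Topology

variable {X : Type*} [MetricSpace X] {A B C D E : Set X}

theorem slowlyOscillating_of_dist_le {φ : X → unitInterval}
    (h : ∀ r > 0, ∀ ε > 0, ∃ K : Set X, IsBounded K ∧
      ∀ x ∉ K, ∀ y, dist y x < r → dist (φ y) (φ x) ≤ ε) : SlowlyOscillating φ := by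
  intro r hr ε hε
  obtain ⟨K, hK, hd⟩ := h r hr (ε / 3) (by positivity)
  refine ⟨K, hK, fun x hx => ?_⟩
  refine (Metric.diam_le_of_forall_dist_le (C := ε / 3 + ε / 3) (by positivity) ?_).trans_lt
    (by linarith)
  rintro _ ⟨y, hy, rfl⟩ _ ⟨z, hz, rfl⟩
  exact (dist_triangle_right _ _ (φ x)).trans (add_le_add (hd x hx y hy) (hd x hx z hz))

theorem SlowlyOscillating.exists_dist_lt {φ : X → unitInterval} (h : SlowlyOscillating φ)
    {r ε : ℝ} (hr : 0 < r) (hε : 0 < ε) : ∃ K : Set X, IsBounded K ∧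
      ∀ x ∉ K, ∀ y, dist y x < r → dist (φ y) (φ x) < ε := by
  obtain ⟨K, hK, hd⟩ := h r hr ε hε
  refine ⟨K, hK, fun x hx y hy => ?_⟩
  refine (Metric.dist_le_diam_of_mem ?_ (Set.mem_image_of_mem φ (Metric.mem_ball.2 hy))
    (Set.mem_image_of_mem φ (Metric.mem_ball_self hr))).trans_lt (hd x hx)
  exact (isCompact_univ (X := unitInterval)).isBounded.subset (Set.subset_univ _)

theorem exists_higsonFunction_bump {K : Set X} (hK : IsBounded K) :
    ∃ φ : HigsonFunction X, (∀ x ∈ K, φ.1 x = 1) ∧ IsBounded {x | φ.1 x ≠ 0} := by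
  rcases K.eq_empty_or_nonempty with rfl | hne
  · refine ⟨⟨fun _ => 0, continuous_const, ?_⟩, by simp, by simp⟩
    exact slowlyOscillating_of_dist_le fun r _ ε hε => ⟨∅, isBounded_empty, by simp [hε.le]⟩
  let φ : X → unitInterval := fun x => Set.projIcc 0 1 zero_le_one (1 - Metric.infDist x K)
  have hφ : {x | φ x ≠ 0} ⊆ Metric.thickening 1 K := by
    intro x hx
    by_contra hx'
    refine hx (Set.projIcc_of_le_left _ ?_)
    rw [Metric.mem_thickening_iff_infDist_lt hne, not_lt] at hx'
    linarith
  have hb : IsBounded {x | φ x ≠ 0} := hK.thickening.subset hφ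
  refine ⟨⟨φ, ?_, ?_⟩, fun x hx => ?_, hb⟩
  · exact continuous_projIcc.comp (continuous_const.sub (Metric.continuous_infDist_pt K))
  · refine slowlyOscillating_of_dist_le fun r _ ε hε =>
      ⟨{x | φ x ≠ 0} ∪ Metric.thickening r {x | φ x ≠ 0}, hb.union hb.thickening,
        fun x hx y hy => ?_⟩
    have hx0 : φ x = 0 := by
      by_contra h
      exact hx (Or.inl h)
    have hy0 : φ y = 0 := by
      by_contra h
      exact hx (Or.inr (Metric.mem_thickening_iff.2 ⟨y, h, by rwa [dist_comm]⟩))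
    rw [hx0, hy0, dist_self]
    exact hε.le
  · change Set.projIcc (0 : ℝ) 1 zero_le_one (1 - Metric.infDist x K) = 1
    rw [Metric.infDist_zero_of_mem hx, sub_zero]
    exact Set.projIcc_right zero_le_one

theorem apply_eq_of_mem_closure {φ : HigsonFunction X} {t : unitInterval}
    (h : ∀ x ∈ A, φ.1 x = t) {ξ : HigsonFunction X → unitInterval}
    (hξ : ξ ∈ closure (higsonMap X '' A)) : ξ φ = t := by
  have hc : IsClosed {η : HigsonFunction X → unitInterval | η φ = t} :=
    isClosed_eq (continuous_apply φ) continuous_const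
  refine closure_minimal ?_ hc hξ
  rintro _ ⟨x, hx, rfl⟩
  exact h x hx

/-- Bump functions turn the condition on bounded sets into equations between coordinates; hence νX
is closed and so compact. -/
theorem mem_higsonCorona_iff {ξ : HigsonFunction X → unitInterval} :
    ξ ∈ higsonCorona X ↔ ξ ∈ higsonCompactification X ∧
      ∀ φ : HigsonFunction X, IsBounded {x | φ.1 x ≠ 0} → ξ φ = 0 := by
  refine and_congr_right fun hξ => ⟨fun h φ hφ => ?_, fun h K hK hKξ => ?_⟩
  · by_contra hne
    have ho : IsOpen {η : HigsonFunction X → unitInterval | η φ ≠ 0} :=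
      isOpen_ne_fun (continuous_apply φ) continuous_const
    refine h _ hφ ?_
    rw [higsonCompactification, mem_closure_iff] at hξ
    rw [mem_closure_iff]
    intro O hO hOξ
    obtain ⟨_, ⟨hxO, hx⟩, x, rfl⟩ := hξ _ (hO.inter ho) ⟨hOξ, hne⟩
    exact ⟨_, hxO, x, hx, rfl⟩
  · obtain ⟨φ, h1, hb⟩ := exists_higsonFunction_bump hK
    have := (apply_eq_of_mem_closure h1 hKξ).symm.trans (h φ hb)
    exact one_ne_zero this

theorem isClosed_higsonCorona : IsClosed (higsonCorona X) := by
  have : higsonCorona X = higsonCompactification X ∩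
      ⋂ φ ∈ {φ : HigsonFunction X | IsBounded {x | φ.1 x ≠ 0}}, {ξ | ξ φ = 0} := by
    ext ξ
    simp [mem_higsonCorona_iff]
  rw [this]
  exact isClosed_closure.inter (isClosed_biInter fun φ _ =>
    isClosed_eq (continuous_apply φ) continuous_const)

instance : CompactSpace (higsonCorona X) :=
  isCompact_iff_compactSpace.1 isClosed_higsonCorona.isCompact

theorem isClosed_coronaTrace (A : Set X) : IsClosed (coronaTrace A) :=
  isClosed_closure.preimage continuous_subtype_val

theorem coronaTrace_mono (h : A ⊆ B) : coronaTrace A ⊆ coronaTrace B :=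
  fun _ hξ => closure_mono (Set.image_mono h) hξ

theorem coronaTrace_union (A B : Set X) :
    coronaTrace (A ∪ B) = coronaTrace A ∪ coronaTrace B := by
  ext ξ
  simp [coronaTrace, Set.image_union, closure_union]

theorem coronaTrace_univ : coronaTrace (Set.univ : Set X) = Set.univ := by
  ext ξ
  simpa [coronaTrace] using show _ ∈ closure _ from ξ.2.1

theorem coronaTrace_eq_empty (h : IsBounded A) : coronaTrace A = ∅ :=
  Set.eq_empty_of_forall_notMem fun ξ hξ => ξ.2.2 A h hξ

theorem coronaTrace_union_compl (A : Set X) : coronaTrace A ∪ coronaTrace Aᶜ = Set.univ := by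
  rw [← coronaTrace_union, Set.union_compl_self, coronaTrace_univ]

theorem coronaTrace_diff_of_isBounded (A : Set X) {K : Set X} (hK : IsBounded K) :
    coronaTrace A ⊆ coronaTrace (A \ K) := by
  have : coronaTrace A ⊆ coronaTrace (A \ K) ∪ coronaTrace K := by
    rw [← coronaTrace_union]
    exact coronaTrace_mono (by simp)
  rwa [coronaTrace_eq_empty hK, Set.union_empty] at this

/-- With u and v the distances to A and B, take u / (u + v). It changes by at most d(x, y) / (u + v)
between x and y, and u + v exceeds any bound off a bounded set because A and B are apart. `h1` keeps
the denominator positive. -/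
theorem exists_higsonFunction_separating (h : AsymptoticallyDisjoint A B) (hA : A.Nonempty)
    (hB : B.Nonempty) (h1 : ∀ a ∈ A, ∀ b ∈ B, 1 ≤ dist a b) :
    ∃ φ : HigsonFunction X, (∀ x ∈ A, φ.1 x = 0) ∧ ∀ x ∈ B, φ.1 x = 1 := by
  let u : X → ℝ := fun x => Metric.infDist x A
  let v : X → ℝ := fun x => Metric.infDist x B
  have hu0 : ∀ x, 0 ≤ u x := fun x => Metric.infDist_nonneg
  have hv0 : ∀ x, 0 ≤ v x := fun x => Metric.infDist_nonneg
  have huc : Continuous u := Metric.continuous_infDist_pt A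
  have hvc : Continuous v := Metric.continuous_infDist_pt B
  have key : ∀ x M, u x + v x < M → ∃ a ∈ A, ∃ b ∈ B, dist x a + dist x b < M := by
    intro x M hM
    obtain ⟨a, ha, hxa⟩ := (Metric.infDist_lt_iff hA).1
      (show u x < u x + (M - u x - v x) / 2 by linarith)
    obtain ⟨b, hb, hxb⟩ := (Metric.infDist_lt_iff hB).1
      (show v x < v x + (M - u x - v x) / 2 by linarith)
    exact ⟨a, ha, b, hb, by linarith⟩
  have hs : ∀ x, 0 < u x + v x := by
    intro x
    by_contra! hx
    obtain ⟨a, ha, b, hb, hab⟩ := key x 1 (by linarith)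
    have := h1 a ha b hb
    have := dist_triangle_left a b x
    linarith
  have hmem : ∀ x, u x / (u x + v x) ∈ Set.Icc (0 : ℝ) 1 := fun x =>
    ⟨div_nonneg (hu0 x) (hs x).le, (div_le_one (hs x)).2 (by linarith [hv0 x])⟩
  have hlip : ∀ x y, |u y / (u y + v y) - u x / (u x + v x)| ≤ dist y x / (u x + v x) := by
    intro x y
    have hu : |u y - u x| ≤ dist y x := by
      simpa [Real.dist_eq] using (Metric.lipschitz_infDist_pt A).dist_le_mul y x
    have hv : |v x - v y| ≤ dist y x := by
      rw [dist_comm]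
      simpa [Real.dist_eq] using (Metric.lipschitz_infDist_pt B).dist_le_mul x y
    have hx := hs x
    have hy := hs y
    have e : u y / (u y + v y) - u x / (u x + v x) =
        (u y * (v x - v y) + v y * (u y - u x)) / (u y + v y) / (u x + v x) := by
      field_simp
      ring
    rw [e, abs_div, abs_of_pos hx]
    refine div_le_div_of_nonneg_right ?_ hx.le
    rw [abs_div, abs_of_pos hy, div_le_iff₀ hy]
    calc |u y * (v x - v y) + v y * (u y - u x)|
        ≤ |u y * (v x - v y)| + |v y * (u y - u x)| := abs_add_le _ _
      _ = u y * |v x - v y| + v y * |u y - u x| := by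
          rw [abs_mul, abs_mul, abs_of_nonneg (hu0 y), abs_of_nonneg (hv0 y)]
      _ ≤ u y * dist y x + v y * dist y x := by
          gcongr
          · exact hu0 y
          · exact hv0 y
      _ = dist y x * (u y + v y) := by ring
  refine ⟨⟨fun x => ⟨_, hmem x⟩, ?_, ?_⟩, fun x hx => ?_, fun x hx => ?_⟩
  · exact (huc.div (huc.add hvc) fun x => (hs x).ne').subtype_mk _
  · refine slowlyOscillating_of_dist_le fun r hr ε hε => ?_
    obtain ⟨K, hK, hd⟩ := asymptoticallyDisjoint_iff.1 h (r / ε)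
    refine ⟨Metric.thickening (r / ε) K, hK.thickening, fun x hx y hy => ?_⟩
    have hM : r / ε ≤ u x + v x := by
      by_contra! hM
      obtain ⟨a, ha, b, hb, hab⟩ := key x _ hM
      have haK := (hd a ha b hb ((dist_triangle_left a b x).trans_lt hab)).1
      exact hx (Metric.mem_thickening_iff.2 ⟨a, haK, by linarith [dist_nonneg (x := x) (y := b)]⟩)
    rw [Subtype.dist_eq, Real.dist_eq]
    refine (hlip x y).trans ?_
    rw [div_le_iff₀ (hs x)]
    rw [div_le_iff₀ hε] at hM
    linarith
  · refine Subtype.ext ?_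
    change u x / (u x + v x) = 0
    rw [show u x = 0 from Metric.infDist_zero_of_mem hx, zero_div]
  · refine Subtype.ext ?_
    change u x / (u x + v x) = 1
    have := hs x
    rw [show v x = 0 from Metric.infDist_zero_of_mem hx, add_zero] at this ⊢
    exact div_self this.ne'

theorem AsymptoticallyDisjoint.disjoint_coronaTrace (h : AsymptoticallyDisjoint A B) :
    Disjoint (coronaTrace A) (coronaTrace B) := by
  rw [Set.disjoint_left]
  intro ξ hA hB
  obtain ⟨K, hK, hd⟩ := h 1
  replace hA := coronaTrace_diff_of_isBounded A hK hA
  replace hB := coronaTrace_diff_of_isBounded B hK hB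
  have hne : ∀ {S : Set X}, ξ ∈ coronaTrace S → S.Nonempty := fun {S} hS =>
    Set.nonempty_iff_ne_empty.2 fun h0 => by simp [coronaTrace, h0] at hS
  obtain ⟨φ, h0, h1⟩ := exists_higsonFunction_separating
    (h.mono Set.sdiff_subset Set.sdiff_subset) (hne hA) (hne hB) hd
  exact zero_ne_one ((apply_eq_of_mem_closure h0 hA).symm.trans (apply_eq_of_mem_closure h1 hB))

/-- Otherwise there are points of A and B less than R from each other that leave every bounded set.
Slow oscillation gives both sequences the same limit along an ultrafilter, and this limit is a
corona point in both traces. -/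
theorem asymptoticallyDisjoint_of_disjoint_coronaTrace
    (h : Disjoint (coronaTrace A) (coronaTrace B)) : AsymptoticallyDisjoint A B := by
  by_contra hnot
  simp only [AsymptoticallyDisjoint, not_forall, not_exists, not_and, not_le] at hnot
  obtain ⟨R, hR⟩ := hnot
  obtain ⟨x₀, -⟩ := hR ∅ isBounded_empty
  have hR' : ∀ n : ℕ, ∃ a b : X, a ∈ A ∧ b ∈ B ∧ a ∉ Metric.ball x₀ n ∧ dist b a < R := by
    intro n
    obtain ⟨a, ha, b, hb, hab⟩ := hR _ (Metric.isBounded_ball (x := x₀) (r := n))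
    exact ⟨a, b, ha.1, hb.1, ha.2, by rwa [dist_comm]⟩
  choose a b ha hb han hab using hR'
  have hR0 : 0 < R := dist_nonneg.trans_lt (hab 0)
  have hesc : ∀ K : Set X, IsBounded K → ∀ᶠ n in atTop, a n ∉ K := by
    intro K hK
    obtain ⟨M, hM⟩ := hK.subset_ball x₀
    obtain ⟨N, hN⟩ := exists_nat_ge M
    filter_upwards [eventually_ge_atTop N] with n hn hnK
    refine han n (Metric.ball_subset_ball ?_ (hM hnK))
    exact hN.trans (by exact_mod_cast hn)
  obtain ⟨ξ, -, hξ⟩ := isCompact_univ.ultrafilter_le_nhds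
    ((hyperfilter ℕ).map fun n => higsonMap X (a n)) (by simp)
  have hξa : Tendsto (fun n => higsonMap X (a n)) (hyperfilter ℕ) (𝓝 ξ) := hξ
  have hle : (hyperfilter ℕ : Filter ℕ) ≤ atTop := Nat.hyperfilter_le_atTop
  have hξb : Tendsto (fun n => higsonMap X (b n)) (hyperfilter ℕ) (𝓝 ξ) := by
    rw [tendsto_pi_nhds] at hξa ⊢
    intro φ
    refine (hξa φ).congr_dist ?_
    rw [Metric.tendsto_nhds]
    intro ε hε
    obtain ⟨K, hK, hd⟩ := φ.2.2.exists_dist_lt hR0 hε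
    filter_upwards [hle (hesc K hK)] with n hn
    rw [Real.dist_0_eq_abs, abs_of_nonneg dist_nonneg, dist_comm]
    exact hd _ hn _ (hab n)
  have hcl : ∀ {S : Set X} {c : ℕ → X}, (∀ n, c n ∈ S) →
      Tendsto (fun n => higsonMap X (c n)) (hyperfilter ℕ) (𝓝 ξ) →
        ξ ∈ closure (higsonMap X '' S) := fun hS ht =>
    mem_closure_of_tendsto ht (Eventually.of_forall fun n => ⟨_, hS n, rfl⟩)
  have hA := hcl ha hξa
  have hcor : ξ ∈ higsonCorona X := by
    rw [mem_higsonCorona_iff]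
    refine ⟨closure_mono (Set.image_subset_range _ _) hA, fun φ hφ => ?_⟩
    refine tendsto_nhds_unique (tendsto_pi_nhds.1 hξa φ) (tendsto_const_nhds.congr' ?_)
    filter_upwards [hle (hesc _ hφ)] with n hn
    exact (not_not.1 hn).symm
  have hA' : (⟨ξ, hcor⟩ : higsonCorona X) ∈ coronaTrace A := hA
  exact Set.disjoint_left.1 h hA' (hcl hb hξb)

theorem exists_coronaTrace_neighbourhood {F : Set (higsonCorona X)} (hF : IsClosed F)
    {ξ : higsonCorona X} (hξ : ξ ∉ F) :
    ∃ E : Set X, ξ ∉ coronaTrace Eᶜ ∧ Disjoint (coronaTrace E) F := by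
  obtain ⟨G, hG, rfl⟩ := isClosed_induced_iff.1 hF
  obtain ⟨W, hW, hWc, hWG⟩ := exists_mem_nhds_isClosed_subset (hG.isOpen_compl.mem_nhds hξ)
  refine ⟨higsonMap X ⁻¹' W, fun h => ?_, ?_⟩
  · obtain ⟨_, hxW, x, hx, rfl⟩ := mem_closure_iff_nhds.1 h W hW
    exact hx hxW
  · rw [Set.disjoint_left]
    intro η hη hηG
    exact hWG (closure_minimal (Set.image_preimage_subset _ _) hWc hη) hηG

/-- The subset `C` of `X` splits all sets asymptotically disjoint from it into two asymptotically
disjoint parts, coherently, with `A` on one side and `B` on the other one. -/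
def CoarselySeparates (A B C : Set X) : Prop :=
  ∃ 𝒰 𝒱 : Set (Set X), (∀ U ∈ 𝒰, ∀ V ∈ 𝒱, AsymptoticallyDisjoint U V) ∧
    (∀ U ∈ 𝒰, AsymptoticallyDisjoint U C) ∧ (∀ V ∈ 𝒱, AsymptoticallyDisjoint V C) ∧
    (∀ D, AsymptoticallyDisjoint D C → ∃ U ∈ 𝒰, ∃ V ∈ 𝒱, D = U ∪ V) ∧ A ∈ 𝒰 ∧ B ∈ 𝒱

/-- A set U of the family has a neighbourhood still apart from C, which splits as U' ∪ V'. The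
traces of V' and of the complement of this neighbourhood are closed and miss the trace of U, and off
both of them only the trace of U' remains. -/
theorem isOpen_sUnion_coronaTrace {𝒰 𝒱 : Set (Set X)}
    (hUV : ∀ U ∈ 𝒰, ∀ V ∈ 𝒱, AsymptoticallyDisjoint U V)
    (hU : ∀ U ∈ 𝒰, AsymptoticallyDisjoint U C)
    (hD : ∀ D, AsymptoticallyDisjoint D C → ∃ U ∈ 𝒰, ∃ V ∈ 𝒱, D = U ∪ V) :
    IsOpen (⋃ U ∈ 𝒰, coronaTrace U) := by
  rw [isOpen_iff_mem_nhds]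
  intro ξ hξ
  simp only [Set.mem_iUnion] at hξ
  obtain ⟨U, hU𝒰, hξ⟩ := hξ
  obtain ⟨U₁, -, hUU₁, hU₁C⟩ := (hU U hU𝒰).exists_between
  obtain ⟨U', hU', V', hV', rfl⟩ := hD U₁ hU₁C
  have hO : IsOpen ((coronaTrace (U' ∪ V')ᶜ)ᶜ ∩ (coronaTrace V')ᶜ) :=
    (isClosed_coronaTrace _).isOpen_compl.inter (isClosed_coronaTrace _).isOpen_compl
  refine Filter.mem_of_superset (hO.mem_nhds ⟨?_, ?_⟩) ?_
  · exact fun h => Set.disjoint_left.1 hUU₁.disjoint_coronaTrace hξ h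
  · exact fun h => Set.disjoint_left.1 (hUV U hU𝒰 V' hV').disjoint_coronaTrace hξ h
  · rintro η ⟨h₁, h₂⟩
    have := (coronaTrace_union_compl (U' ∪ V')).ge (Set.mem_univ η)
    rw [coronaTrace_union] at this
    rcases this with (h | h) | h
    · exact Set.mem_biUnion hU' h
    · exact absurd h h₂
    · exact absurd h h₁

theorem CoarselySeparates.isPartition (h : CoarselySeparates A B C) :
    IsPartition (coronaTrace A) (coronaTrace B) (coronaTrace C) := by
  obtain ⟨𝒰, 𝒱, hUV, hU, hV, hD, hA, hB⟩ := h
  refine ⟨⋃ U ∈ 𝒰, coronaTrace U, ⋃ V ∈ 𝒱, coronaTrace V, isOpen_sUnion_coronaTrace hUV hU hD,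
    isOpen_sUnion_coronaTrace (fun V hV U hU => (hUV U hU V hV).symm) hV fun D hDC => ?_,
    ?_, ?_, Set.subset_biUnion_of_mem hA, Set.subset_biUnion_of_mem hB⟩
  · obtain ⟨U, hU, V, hV, rfl⟩ := hD D hDC
    exact ⟨V, hV, U, hU, Set.union_comm _ _⟩
  · simp only [Set.disjoint_iUnion_left, Set.disjoint_iUnion_right]
    exact fun V hV U hU => (hUV U hU V hV).disjoint_coronaTrace
  · ext ξ
    constructor
    · intro hξ
      obtain ⟨E, hE, hEC⟩ := exists_coronaTrace_neighbourhood (isClosed_coronaTrace C) hξ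
      obtain ⟨U, hU, V, hV, rfl⟩ := hD E (asymptoticallyDisjoint_of_disjoint_coronaTrace hEC)
      have := (coronaTrace_union_compl (U ∪ V)).ge (Set.mem_univ ξ)
      rw [coronaTrace_union] at this
      rcases this with (h | h) | h
      · exact Or.inl (Set.mem_biUnion hU h)
      · exact Or.inr (Set.mem_biUnion hV h)
      · exact absurd h hE
    · simp only [Set.mem_union, Set.mem_iUnion]
      rintro (⟨U, hU', hξ⟩ | ⟨V, hV', hξ⟩)
      · exact Set.disjoint_left.1 (hU U hU').disjoint_coronaTrace hξ
      · exact Set.disjoint_left.1 (hV V hV').disjoint_coronaTrace hξ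

theorem exists_coronaTrace_between {F G : Set (higsonCorona X)} (hF : IsClosed F)
    (hG : IsClosed G) (hFG : Disjoint F G) :
    ∃ E : Set X, Disjoint F (coronaTrace Eᶜ) ∧ Disjoint (coronaTrace E) G := by
  choose! E hE hEG using fun ξ (hξ : ξ ∈ F) =>
    exists_coronaTrace_neighbourhood hG (Set.disjoint_left.1 hFG hξ)
  refine hF.isCompact.induction_on
    (p := fun F => ∃ E : Set X, Disjoint F (coronaTrace Eᶜ) ∧ Disjoint (coronaTrace E) G)
    ⟨∅, by simp, by simp [coronaTrace_eq_empty isBounded_empty]⟩ ?_ ?_ ?_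
  · rintro s t hst ⟨E, hE, hEG⟩
    exact ⟨E, hE.mono_left hst, hEG⟩
  · rintro s t ⟨E, hE, hEG⟩ ⟨E', hE', hEG'⟩
    refine ⟨E ∪ E', Disjoint.union_left ?_ ?_, ?_⟩
    · exact hE.mono_right (coronaTrace_mono (Set.compl_subset_compl.2 Set.subset_union_left))
    · exact hE'.mono_right (coronaTrace_mono (Set.compl_subset_compl.2 Set.subset_union_right))
    · rw [coronaTrace_union]
      exact hEG.union_left hEG'
  · intro ξ hξ
    exact ⟨_, mem_nhdsWithin_of_mem_nhds
      ((isClosed_coronaTrace _).isOpen_compl.mem_nhds (hE ξ hξ)), E ξ,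
      disjoint_compl_left, hEG ξ hξ⟩

/-- From a partition, the families consist of the sets with trace in one of its two open sides. The
trace of a set D apart from C meets these sides in disjoint closed sets; a set E separating them in
νX cuts D into D ∩ E and D \ E. -/
theorem coarselySeparates_iff :
    CoarselySeparates A B C ↔
      IsPartition (coronaTrace A) (coronaTrace B) (coronaTrace C) := by
  refine ⟨CoarselySeparates.isPartition, ?_⟩
  rintro ⟨U, V, hU, hV, hUV, hC, hA, hB⟩
  have hUC : Disjoint U (coronaTrace C) :=
    Set.disjoint_left.2 fun ξ hξ => hC.ge (Or.inl hξ)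
  have hVC : Disjoint V (coronaTrace C) :=
    Set.disjoint_left.2 fun ξ hξ => hC.ge (Or.inr hξ)
  refine ⟨{D | coronaTrace D ⊆ U}, {D | coronaTrace D ⊆ V}, fun D hD E hE => ?_, fun D hD => ?_,
    fun D hD => ?_, fun D hD => ?_, hA, hB⟩
  · exact asymptoticallyDisjoint_of_disjoint_coronaTrace (hUV.mono hD hE)
  · exact asymptoticallyDisjoint_of_disjoint_coronaTrace (hUC.mono_left hD)
  · exact asymptoticallyDisjoint_of_disjoint_coronaTrace (hVC.mono_left hD)
  · have hDUV : coronaTrace D ⊆ U ∪ V := by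
      rw [← hC]
      exact fun ξ hξ => Set.disjoint_left.1 hD.disjoint_coronaTrace hξ
    obtain ⟨E, hE₁, hE₂⟩ := exists_coronaTrace_between
      (F := coronaTrace D ∩ Vᶜ) (G := coronaTrace D ∩ Uᶜ)
      ((isClosed_coronaTrace D).inter hV.isClosed_compl)
      ((isClosed_coronaTrace D).inter hU.isClosed_compl)
      (Set.disjoint_left.2 fun ξ h h' => (hDUV h.1).elim h'.2 h.2)
    refine ⟨D ∩ E, fun ξ hξ => ?_, D \ E, fun ξ hξ => ?_, (Set.inter_union_sdiff D E).symm⟩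
    · by_contra hξU
      exact Set.disjoint_left.1 hE₂ (coronaTrace_mono Set.inter_subset_right hξ)
        ⟨coronaTrace_mono Set.inter_subset_left hξ, hξU⟩
    · by_contra hξV
      exact Set.disjoint_left.1 hE₁ ⟨coronaTrace_mono Set.sdiff_subset hξ, hξV⟩
        (coronaTrace_mono (fun x hx => hx.2) hξ)

end HigsonCorona

/-! ### The subspace theorem and the addition theorem. -/

section AsymptoticInductiveDimension

open Bornology

variable {X : Type u} [MetricSpace X] {A B C : Set X} {k : ℕ}

theorem asIndLE_succ_iff : AsIndLE (k + 1) X ↔ ∀ A B : Set X, AsymptoticallyDisjoint A B →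
    ∃ C : Set X, IsClosed C ∧ CoarselySeparates A B C ∧ AsIndLE k C := by
  simp only [AsIndLE, IsAsymptoticSeparator, coarselySeparates_iff, and_assoc]

/-- Subspace theorem: the asymptotic large inductive dimension is monotone under bilipschitz
embeddings. -/
theorem AsIndLE.of_isBilipschitz {X Y : Type u} [MetricSpace X] [MetricSpace Y] {f : X → Y}
    (hf : IsBilipschitz f) (h : AsIndLE k Y) : AsIndLE k X := by
  induction k generalizing X Y with
  | zero => exact hf.isBounded_preimage (show IsBounded (Set.univ : Set Y) from h)
  | succ k ih =>
    rw [asIndLE_succ_iff] at h ⊢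
    intro A B hAB
    obtain ⟨A₁, B₁, hA, hB, hA₁, hB₁, h₁⟩ := hAB.exists_neighbourhoods
    obtain ⟨C, -, ⟨𝒰, 𝒱, hUV, hU, hV, hD, hA𝒰, hB𝒱⟩, hk⟩ :=
      h _ _ (hf.asymptoticallyDisjoint_image_iff.2 h₁)
    obtain ⟨E, hE, hET⟩ := exists_bilipschitz_trace hf C
    -- E may come close to A and B, so their neighbourhoods are removed. Nothing is lost: the images
    -- of `A₁` and `B₁` are apart from C.
    obtain ⟨hcl, g, hg⟩ := hE (E \ (A₁ ∪ B₁)) Set.sdiff_subset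
    have hE₁ : AsymptoticallyDisjoint (f '' (A₁ ∪ B₁)) C := by
      rw [Set.image_union]
      exact (hU _ hA𝒰).union_left (hV _ hB𝒱)
    have hlift : ∀ D, AsymptoticallyDisjoint D (E \ (A₁ ∪ B₁)) →
        AsymptoticallyDisjoint (f '' D) C := by
      intro D hDE R
      obtain ⟨c, hc, hf'⟩ := id hf
      obtain ⟨T, hT⟩ := hET R
      obtain ⟨K₁, hK₁, hd₁⟩ := asymptoticallyDisjoint_iff.1 hDE (T + 1)
      obtain ⟨K₂, hK₂, hd₂⟩ := asymptoticallyDisjoint_iff.1 hE₁ (c * T + R)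
      refine ⟨f '' K₁ ∪ K₂, (hf.isBounded_image hK₁).union hK₂, ?_⟩
      rintro _ ⟨⟨x, hx, rfl⟩, hxK⟩ y ⟨hy, hyK⟩
      by_contra! hxy
      obtain ⟨e, he, hxe⟩ := hT x ⟨y, hy, hxy⟩
      by_cases heA : e ∈ A₁ ∪ B₁
      · refine hyK (Or.inr (hd₂ _ ⟨e, heA, rfl⟩ y hy ?_).2)
        calc dist (f e) y ≤ dist (f x) (f e) + dist (f x) y := dist_triangle_left _ _ _
          _ < c * T + R :=
            add_lt_add_of_le_of_lt ((hf' x e).2.trans (mul_le_mul_of_nonneg_left hxe hc.le)) hxy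
      · exact hxK (Or.inl ⟨x, (hd₁ x hx e ⟨he, heA⟩ (by linarith)).1, rfl⟩)
    refine ⟨_, hcl, ?_, ih hg hk⟩
    refine ⟨{D | AsymptoticallyDisjoint D (E \ (A₁ ∪ B₁)) ∧ ∃ U ∈ 𝒰, f '' D ⊆ U},
      {D | AsymptoticallyDisjoint D (E \ (A₁ ∪ B₁)) ∧ ∃ V ∈ 𝒱, f '' D ⊆ V}, ?_,
      fun D hD => hD.1, fun D hD => hD.1, fun D hDE => ?_, ⟨?_, _, hA𝒰, Set.image_mono hA⟩,
      ⟨?_, _, hB𝒱, Set.image_mono hB⟩⟩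
    · rintro D ⟨-, U, hU, hDU⟩ D' ⟨-, V, hV, hDV⟩
      exact hf.asymptoticallyDisjoint_image_iff.1 ((hUV U hU V hV).mono hDU hDV)
    · obtain ⟨U, hU, V, hV, hUV⟩ := hD _ (hlift D hDE)
      refine ⟨D ∩ f ⁻¹' U, ⟨hDE.mono Set.inter_subset_left subset_rfl, U, hU, ?_⟩,
        D ∩ f ⁻¹' V, ⟨hDE.mono Set.inter_subset_left subset_rfl, V, hV, ?_⟩, ?_⟩
      · exact (Set.image_mono Set.inter_subset_right).trans (Set.image_preimage_subset f U)
      · exact (Set.image_mono Set.inter_subset_right).trans (Set.image_preimage_subset f V)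
      · rw [← Set.inter_union_distrib_left, eq_comm, Set.inter_eq_left, ← Set.preimage_union,
          ← hUV]
        exact Set.subset_preimage_image f D
    · exact hA₁.mono subset_rfl fun x hx h => hx.2 (Or.inl h)
    · exact hB₁.mono subset_rfl fun x hx h => hx.2 (Or.inr h)

/-- The separators that `asInd Y ≤ k` provides, in terms of the ambient space. -/
theorem AsIndLE.exists_relative_separator {Y : Set X} (h : AsIndLE (k + 1) Y)
    (hAB : AsymptoticallyDisjoint A B) :
    ∃ C ⊆ Y, AsIndLE k C ∧ ∃ 𝒰 𝒱 : Set (Set X),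
      (∀ U ∈ 𝒰, U ⊆ Y) ∧ (∀ V ∈ 𝒱, V ⊆ Y) ∧
      (∀ U ∈ 𝒰, ∀ V ∈ 𝒱, AsymptoticallyDisjoint U V) ∧
      (∀ U ∈ 𝒰, AsymptoticallyDisjoint U C) ∧ (∀ V ∈ 𝒱, AsymptoticallyDisjoint V C) ∧
      (∀ D ⊆ Y, AsymptoticallyDisjoint D C → ∃ U ∈ 𝒰, ∃ V ∈ 𝒱, D = U ∪ V) ∧
      A ∩ Y ∈ 𝒰 ∧ B ∩ Y ∈ 𝒱 := by
  have hv : IsBilipschitz ((↑) : Y → X) := isometry_subtype_coe.isBilipschitz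
  have hpre : ∀ S : Set X, ((↑) : Y → X) '' (((↑) : Y → X) ⁻¹' S) = S ∩ Y := fun S => by
    rw [Subtype.image_preimage_coe, Set.inter_comm]
  obtain ⟨C, -, ⟨𝒰, 𝒱, hUV, hU, hV, hD, hA, hB⟩, hk⟩ := asIndLE_succ_iff.1 h
    (((↑) : Y → X) ⁻¹' A) (((↑) : Y → X) ⁻¹' B) (by
      rw [← hv.asymptoticallyDisjoint_image_iff, hpre, hpre]
      exact hAB.mono Set.inter_subset_left Set.inter_subset_left)
  refine ⟨(↑) '' C, Subtype.coe_image_subset _ _, ?_,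
    Set.image ((↑) : Y → X) '' 𝒰, Set.image ((↑) : Y → X) '' 𝒱, ?_, ?_, ?_, ?_, ?_, ?_,
    ⟨_, hA, hpre A⟩, ⟨_, hB, hpre B⟩⟩
  · choose g hgC hg using fun x : ((↑) '' C : Set X) => x.2
    refine hk.of_isBilipschitz (f := fun x => (⟨g x, hgC x⟩ : C)) (Isometry.isBilipschitz ?_)
    refine Isometry.of_dist_eq fun x y => ?_
    rw [Subtype.dist_eq, Subtype.dist_eq, Subtype.dist_eq x y, ← hg x, ← hg y]
  · rintro _ ⟨U, -, rfl⟩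
    exact Subtype.coe_image_subset _ _
  · rintro _ ⟨V, -, rfl⟩
    exact Subtype.coe_image_subset _ _
  · rintro _ ⟨U, hU', rfl⟩ _ ⟨V, hV', rfl⟩
    exact hv.asymptoticallyDisjoint_image_iff.2 (hUV U hU' V hV')
  · rintro _ ⟨U, hU', rfl⟩
    exact hv.asymptoticallyDisjoint_image_iff.2 (hU U hU')
  · rintro _ ⟨V, hV', rfl⟩
    exact hv.asymptoticallyDisjoint_image_iff.2 (hV V hV')
  · intro D hDY hDC
    obtain ⟨D, rfl⟩ := Set.subset_range_iff_exists_image_eq.1 (hDY.trans_eq Subtype.range_coe.symm)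
    obtain ⟨U, hU, V, hV, rfl⟩ := hD D (hv.asymptoticallyDisjoint_image_iff.1 hDC)
    exact ⟨_, ⟨U, hU, rfl⟩, _, ⟨V, hV, rfl⟩, Set.image_union _ _ _⟩

theorem isBilipschitz_inclusion {S T : Set X} (h : S ⊆ T) : IsBilipschitz (Set.inclusion h) :=
  Isometry.isBilipschitz (Isometry.of_dist_eq fun _ _ => rfl)

theorem AsIndLE.mono_set {S T : Set X} (hST : S ⊆ T) (h : AsIndLE k T) : AsIndLE k S :=
  h.of_isBilipschitz (isBilipschitz_inclusion hST)

theorem AsIndLE.union_zero {n : ℕ} {Y Z : Set X} (hYZ : Y ∪ Z = Set.univ) (hY : AsIndLE 1 Y)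
    (hZ : AsIndLE (n + 1) Z) : AsIndLE (n + 1) X := by
  rw [asIndLE_succ_iff]
  intro A B hAB
  obtain ⟨A₁, B₁, hAA₁, hBB₁, hA₁, hB₁, h₁⟩ := hAB.exists_neighbourhoods
  obtain ⟨C₁, hC₁, hC₁b, 𝒰, 𝒱, hUY, hVY, hUV, -, -, hD, hA, hB⟩ := hY.exists_relative_separator h₁
  -- A bounded separator is apart from everything, so Y itself is split.
  obtain ⟨Y₁, hY₁, Y₂, hY₂, rfl⟩ := hD Y subset_rfl (by
    have hb : IsBounded C₁ := by
      have := isometry_subtype_coe.isBilipschitz.isBounded_image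
        (f := ((↑) : C₁ → X)) (show IsBounded (Set.univ : Set C₁) from hC₁b)
      simpa using this
    exact (AsymptoticallyDisjoint.of_isBounded hb _).symm)
  have hAY₂ : AsymptoticallyDisjoint A Y₂ :=
    (hA₁.of_inter (hVY _ hY₂) (hUV _ hA _ hY₂).symm).symm
  have hBY₁ : AsymptoticallyDisjoint Y₁ B := hB₁.of_inter (hUY _ hY₁) (hUV _ hY₁ _ hB)
  have hPQ : AsymptoticallyDisjoint (A ∪ Y₁) (B ∪ Y₂) :=
    (hAB.union_right hAY₂).union_left (hBY₁.union_right (hUV _ hY₁ _ hY₂))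
  -- A separator inside Z only controls the parts of the given sets in Z. Separating P and Q leaves
  -- the margin that `of_inter` needs to keep subsets of Z apart from all of A ∪ Y₁ or B ∪ Y₂.
  obtain ⟨P, Q, hAP, hBQ, hP, hQ, h₂⟩ := hPQ.exists_neighbourhoods
  obtain ⟨C, hCZ, hk, 𝒰', 𝒱', hUZ, hVZ, hUV', hUC, hVC, hD', hA', hB'⟩ :=
    hZ.exists_relative_separator h₂
  obtain ⟨N, hNC, hNcl, hN⟩ := exists_net C
  have hnet : ∀ D, AsymptoticallyDisjoint D N → AsymptoticallyDisjoint D C :=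
    fun D hD => (hD.symm.of_near 1 hN).symm
  refine ⟨N, hNcl, ?_, hk.mono_set hNC⟩
  refine ⟨{D | AsymptoticallyDisjoint D N ∧ ∃ U ∈ 𝒰', D ⊆ U ∪ (A ∪ Y₁)},
    {D | AsymptoticallyDisjoint D N ∧ ∃ V ∈ 𝒱', D ⊆ V ∪ (B ∪ Y₂)}, ?_, fun D hD => hD.1,
    fun D hD => hD.1, fun D hD => ?_, ⟨?_, _, hA', ?_⟩, ⟨?_, _, hB', ?_⟩⟩
  · rintro D ⟨-, U, hU, hDU⟩ E ⟨-, V, hV, hEV⟩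
    refine AsymptoticallyDisjoint.mono ?_ hDU hEV
    refine .union_left (.union_right (hUV' _ hU _ hV) ?_) (.union_right ?_ hPQ)
    · exact hQ.of_inter (hUZ _ hU) (hUV' _ hU _ hB')
    · exact (hP.of_inter (hVZ _ hV) (hUV' _ hA' _ hV).symm).symm
  · obtain ⟨U, hU, V, hV, hE⟩ := hD' (D ∩ Z) Set.inter_subset_right
      ((hnet D hD).mono Set.inter_subset_left subset_rfl)
    refine ⟨D ∩ (U ∪ Y₁), ⟨hD.mono Set.inter_subset_left subset_rfl, U, hU, ?_⟩,
      D ∩ (V ∪ Y₂), ⟨hD.mono Set.inter_subset_left subset_rfl, V, hV, ?_⟩, ?_⟩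
    · rintro x ⟨-, hx | hx⟩
      exacts [Or.inl hx, Or.inr (Or.inr hx)]
    · rintro x ⟨-, hx | hx⟩
      exacts [Or.inl hx, Or.inr (Or.inr hx)]
    · rw [← Set.inter_union_distrib_left, eq_comm, Set.inter_eq_left]
      intro x hx
      rcases hYZ.ge (Set.mem_univ x) with (h | h) | h
      · exact Or.inl (Or.inr h)
      · exact Or.inr (Or.inr h)
      · rcases hE.le ⟨hx, h⟩ with h' | h'
        · exact Or.inl (Or.inl h')
        · exact Or.inr (Or.inl h')
  · exact ((hP.of_inter hCZ (hUC _ hA').symm).symm).mono Set.subset_union_left hNC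
  · exact Set.subset_union_left.trans Set.subset_union_right
  · exact ((hQ.of_inter hCZ (hVC _ hB').symm).symm).mono Set.subset_union_left hNC
  · exact Set.subset_union_left.trans Set.subset_union_right

theorem AsIndLE.union {m n : ℕ} {Y Z : Set X} (hYZ : Y ∪ Z = Set.univ)
    (hY : AsIndLE (m + 1) Y) (hZ : AsIndLE (n + 1) Z) : AsIndLE (m + n + 1) X := by
  induction m generalizing X with
  | zero => simpa using AsIndLE.union_zero hYZ hY hZ
  | succ m ih =>
    rw [asIndLE_succ_iff]
    intro A B hAB
    obtain ⟨A₁, B₁, hAA₁, hBB₁, hA₁, hB₁, h₁⟩ := hAB.exists_neighbourhoods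
    -- Two margins are needed: the outer one makes C apart from `A₁` and `B₁`, the inner one keeps
    -- the separator apart from A and B once `A₁` and `B₁` are removed.
    obtain ⟨A₂, B₂, hAA₂, hBB₂, hA₂, hB₂, h₂⟩ := h₁.exists_neighbourhoods
    obtain ⟨C, hCY, hk, 𝒰, 𝒱, hUY, hVY, hUV, hUC, hVC, hD, hA, hB⟩ :=
      hY.exists_relative_separator h₂
    obtain ⟨N, hNS, hNcl, hN⟩ := exists_net ((C ∪ Z) \ (A₁ ∪ B₁))
    have hCA : AsymptoticallyDisjoint C A₁ := hA₂.of_inter hCY (hUC _ hA).symm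
    have hCB : AsymptoticallyDisjoint C B₁ := hB₂.of_inter hCY (hVC _ hB).symm
    refine ⟨N, hNcl, ?_, ?_⟩
    -- The bounded set K absorbs the points of D in (C ∪ Z) \ (A₁ ∪ B₁), which belong to neither
    -- side.
    · refine ⟨{D | AsymptoticallyDisjoint D N ∧ ∃ U ∈ 𝒰, ∃ K, IsBounded K ∧ D ⊆ U ∪ A₁ ∪ K},
        {D | AsymptoticallyDisjoint D N ∧ ∃ V ∈ 𝒱, D ⊆ V ∪ B₁}, ?_, fun D hD => hD.1,
        fun D hD => hD.1, fun D hDN => ?_, ⟨?_, _, hA, ∅, isBounded_empty, ?_⟩, ⟨?_, _, hB, ?_⟩⟩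
      · rintro D ⟨-, U, hU, K, hK, hDU⟩ E ⟨-, V, hV, hEV⟩
        refine AsymptoticallyDisjoint.mono ?_ hDU hEV
        refine .union_left (.union_left (.union_right (hUV _ hU _ hV) ?_) (.union_right ?_ h₁))
          (.of_isBounded hK _)
        · exact hB₂.of_inter (hUY _ hU) (hUV _ hU _ hB)
        · exact (hA₂.of_inter (hVY _ hV) (hUV _ hA _ hV).symm).symm
      · have hDS : AsymptoticallyDisjoint D ((C ∪ Z) \ (A₁ ∪ B₁)) :=
          (hDN.symm.of_near 1 hN).symm
        have hb := hDS.isBounded_inter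
        have hDC : AsymptoticallyDisjoint (D ∩ Y) C := by
          have hC : C ⊆ (C ∪ Z) \ (A₁ ∪ B₁) ∪ (C ∩ A₁ ∪ C ∩ B₁) := by
            intro x hx
            by_cases hxA : x ∈ A₁ ∪ B₁
            · rw [← Set.inter_union_distrib_left]
              exact Or.inr ⟨hx, hxA⟩
            · exact Or.inl ⟨Or.inl hx, hxA⟩
          refine (hDS.union_right (AsymptoticallyDisjoint.symm ?_)).mono
            Set.inter_subset_left hC
          exact .of_isBounded (hCA.isBounded_inter.union hCB.isBounded_inter) _
        obtain ⟨U, hU, V, hV, hE⟩ := hD _ Set.inter_subset_right hDC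
        refine ⟨D ∩ (U ∪ A₁ ∪ D ∩ ((C ∪ Z) \ (A₁ ∪ B₁))),
          ⟨hDN.mono Set.inter_subset_left subset_rfl, U, hU, _, hb, Set.inter_subset_right⟩,
          D ∩ (V ∪ B₁),
          ⟨hDN.mono Set.inter_subset_left subset_rfl, V, hV, Set.inter_subset_right⟩, ?_⟩
        rw [← Set.inter_union_distrib_left, eq_comm, Set.inter_eq_left]
        intro x hx
        by_cases hxA : x ∈ A₁
        · exact Or.inl (Or.inl (Or.inr hxA))
        by_cases hxB : x ∈ B₁
        · exact Or.inr (Or.inr hxB)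
        rcases hYZ.ge (Set.mem_univ x) with h | h
        · rcases hE.le ⟨hx, h⟩ with h' | h'
          · exact Or.inl (Or.inl (Or.inl h'))
          · exact Or.inr (Or.inl h')
        · exact Or.inl (Or.inr ⟨hx, Or.inr h, fun h' => h'.elim hxA hxB⟩)
      · exact hA₁.mono subset_rfl fun x hx h =>
          (hNS hx).2 (Or.inl h)
      · exact hAA₁.trans (Set.subset_union_right.trans Set.subset_union_left)
      · exact hB₁.mono subset_rfl fun x hx h => (hNS hx).2 (Or.inr h)
      · exact hBB₁.trans Set.subset_union_right
    · rw [add_right_comm]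
      refine ih (Y := {x : N | x.1 ∈ C}) (Z := {x : N | x.1 ∈ Z}) ?_ ?_ ?_
      · exact Set.eq_univ_of_forall fun x => (hNS x.2).1
      · exact hk.of_isBilipschitz (f := fun x => (⟨x.1.1, x.2⟩ : C))
          (Isometry.isBilipschitz (Isometry.of_dist_eq fun _ _ => rfl))
      · exact hZ.of_isBilipschitz (f := fun x => (⟨x.1.1, x.2⟩ : Z))
          (Isometry.isBilipschitz (Isometry.of_dist_eq fun _ _ => rfl))

end AsymptoticInductiveDimension

theorem theorem3 {X : Type*} [MetricSpace X] [ProperSpace X] (Y Z : Set X)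
    (hYZ : Y ∪ Z = Set.univ) (hY : ¬ Bornology.IsBounded Y) (hZ : ¬ Bornology.IsBounded Z) :
    asInd X ≤ asInd Y + asInd Z := by
  -- Unboundedness excludes the value -1, so both indices have the successor form that the addition
  -- theorem requires.
  have hpos : ∀ {S : Set X}, ¬ Bornology.IsBounded S → ∀ {k}, AsIndLE k S → ∃ m, k = m + 1 := by
    rintro S hS (_ | m) h
    · refine absurd ?_ hS
      have := isometry_subtype_coe.isBilipschitz.isBounded_image
        (f := ((↑) : S → X)) (show Bornology.IsBounded (Set.univ : Set S) from h)
      simpa using this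
    · exact ⟨m, rfl⟩
  classical
  by_cases hY' : ∃ k, AsIndLE k Y
  swap
  · simp [asInd, hY']
  by_cases hZ' : ∃ k, AsIndLE k Z
  swap
  · simp [asInd, hZ']
  obtain ⟨m, hm⟩ := hpos hY (Nat.find_spec hY')
  obtain ⟨n, hn⟩ := hpos hZ (Nat.find_spec hZ')
  have hX : AsIndLE (m + n + 1) X :=
    AsIndLE.union hYZ (hm ▸ Nat.find_spec hY') (hn ▸ Nat.find_spec hZ')
  have hX' : ∃ k, AsIndLE k X := ⟨_, hX⟩
  have hle : Nat.find hX' ≤ m + n + 1 := Nat.find_min' hX' hX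
  simp only [asInd, dif_pos hX', dif_pos hY', dif_pos hZ']
  rw [← WithTop.coe_add, WithTop.coe_le_coe, hm, hn]
  push_cast
  omega
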